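/- Let $P(\lambda)=\sum_{j=-k}^{k}A_j\lambda^j$, $A_j\in\mathbb C^{n\times n}$, be a regular ($\det P\not\equiv 0$) T-palindromic Laurent matrix polynomial, i.e. $A_{-j}=A_j^T$ for all $j$ (the Laurent form $\lambda^{-k}\tilde P(\lambda)$ of a T-palindromic matrix polynomial $\tilde P$ of even degree $2k$). Put $y=\lambda+\lambda^{-1}$ and $w=\lambda-\lambda^{-1}$. Then there are unique matrix polynomials $B(y),C(y)\in\mathbb C[y]^{n\times n}$ such that $P(\lambda)=B(y)+w\,C(y)$. Let $$M(y)=\begin{pmatrix}B(y)&w^2C(y)\\ C(y)&B(y)\end{pmatrix},\qquad w^2=y^2-4,$$ a matrix polynomial in $y$ of size $2n\times 2n$. For a matrix function $F$ that is analytic near $z_0$, a Jordan chain of length $\ell\ge 1$ of $F$ at $z_0$ is a sequence of vectors $x_0\neq 0,x_1,\dots,x_{\ell-1}$ with $\sum_{i=0}^{m}\frac{F^{(m-i)}(z_0)}{(m-i)!}x_i=0$ for $m=0,\dots,\ell-1$. A canonical system of Jordan chains of $F$ at $z_0$ is a finite sequence of Jordan chains such that each of them has a leading vector $x_0$ outside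 the span of the leading vectors of the preceding ones and has the greatest length among all Jordan chains with this property, and such that the leading vectors of all of them span $\ker F(z_0)$. The Jordan structure of $F$ at $z_0$ is the multiset of the lengths of the chains in a canonical system (empty if $z_0$ is not an eigenvalue). Let $\lambda_0\in\mathbb C$ with $\lambda_0\neq 0,1,-1$, and let $y_0=\lambda_0+\lambda_0^{-1}$. Then $y_0$ is an eigenvalue of $M$ if and only if $\lambda_0$ is an eigenvalue of $P$, and if and only if $\lambda_0^{-1}$ is an eigenvalue of $P$. Canonical systems of Jordan chains exist for $P$ at $\lambda_0$, for $P$ at $\lambda_0^{-1}$ and for $M$ at $y_0$; at each of these points any two canonical systems have the same multiset of lengths; and the Jordan structure of $M$ at $y_0$ is the union, counted with multiplicity (the multiset sum), of the Jordan structures of $P$ at $\lambda_0$ and at $\lambda_0^{-1}$. -/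

import Mathlib

open scoped Matrix LaurentPolynomial Polynomial

noncomputable section

namespace PalindromicPencil

/-! ### Jordan chains and Jordan structure of a matrix function -/

section Jordan

variable {ι : Type*} [Fintype ι]

/-- The entrywise `q`-th derivative at `z₀` of a matrix function `F`. -/
def matrixDeriv (F : ℂ → Matrix ι ι ℂ) (q : ℕ) (z₀ : ℂ) : Matrix ι ι ℂ :=
  Matrix.of fun a b => iteratedDeriv q (fun z => F z a b) z₀

/-- The vectors `x 0, …, x (ℓ - 1)` form a Jordan chain of length `ℓ ≥ 1` of `F` at `z₀`:
`x 0 ≠ 0` and `∑_{i ≤ m} F^{(m-i)}(z₀) / (m-i)! · x i = 0` for every `m < ℓ`.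
The values of `x` at indices `≥ ℓ` play no role. -/
def IsJordanChain (F : ℂ → Matrix ι ι ℂ) (z₀ : ℂ) (ℓ : ℕ) (x : ℕ → ι → ℂ) : Prop :=
  0 < ℓ ∧ x 0 ≠ 0 ∧
    ∀ m < ℓ, ∑ i ∈ Finset.range (m + 1),
      (((m - i).factorial : ℂ)⁻¹ • matrixDeriv F (m - i) z₀) *ᵥ x i = 0

/-- A canonical system of Jordan chains of `F` at `z₀`: `r` Jordan chains `x 0, …, x (r - 1)` of
lengths `ℓ 0, …, ℓ (r - 1)`, chosen so that each chain has the greatest length among all the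
Jordan chains whose leading vector is not in the span of the leading vectors of the preceding
chains, and so that the leading vectors together span the kernel of `F z₀`. -/
structure IsCanonicalSystem (F : ℂ → Matrix ι ι ℂ) (z₀ : ℂ) (r : ℕ)
    (ℓ : Fin r → ℕ) (x : Fin r → ℕ → ι → ℂ) : Prop where
  chain : ∀ i, IsJordanChain F z₀ (ℓ i) (x i)
  notMem_span : ∀ i, x i 0 ∉ Submodule.span ℂ ((fun j => x j 0) '' {j | j < i})
  maximal : ∀ i (m : ℕ) (v : ℕ → ι → ℂ), IsJordanChain F z₀ m v →
    v 0 ∉ Submodule.span ℂ ((fun j => x j 0) '' {j | j < i}) → m ≤ ℓ i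
  span_eq : Submodule.span ℂ (Set.range fun j => x j 0) = LinearMap.ker (F z₀).mulVecLin

/-- `σ` is the Jordan structure of `F` at `z₀`: the multiset of the lengths of the chains in a
canonical system of Jordan chains. A canonical system is required to exist, and all canonical
systems are required to have the same multiset `σ` of lengths. -/
def HasJordanStructure (F : ℂ → Matrix ι ι ℂ) (z₀ : ℂ) (σ : Multiset ℕ) : Prop :=
  (∃ (r : ℕ) (ℓ : Fin r → ℕ) (x : Fin r → ℕ → ι → ℂ), IsCanonicalSystem F z₀ r ℓ x) ∧
    ∀ (r : ℕ) (ℓ : Fin r → ℕ) (x : Fin r → ℕ → ι → ℂ),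
      IsCanonicalSystem F z₀ r ℓ x → Finset.univ.val.map ℓ = σ

end Jordan

/-! ### Matrix polynomials and Laurent matrix polynomials -/

section Polynomials

variable {ι : Type*}

/-- The matrix function `y ↦ Q(y)` of a matrix polynomial. -/
def polyFun (Q : Matrix ι ι ℂ[X]) (y : ℂ) : Matrix ι ι ℂ :=
  Q.map fun q => q.eval y

/-- The matrix coefficient `A_j` of `P(λ) = ∑ j, A_j λ ^ j`. -/
def coeffMatrix (P : Matrix ι ι ℂ[T;T⁻¹]) (j : ℤ) : Matrix ι ι ℂ :=
  P.map fun p => p.coeff j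

/-- The matrix function `z ↦ ∑ j, A_j z ^ j` of a Laurent matrix polynomial (used for `z ≠ 0`). -/
def laurentFun (P : Matrix ι ι ℂ[T;T⁻¹]) (z : ℂ) : Matrix ι ι ℂ :=
  P.map fun p => p.coeff.sum fun j a => a * z ^ j

/-- `P` is T-palindromic: `A_{-j} = A_jᵀ` for every `j`. -/
def IsTPalindromic (P : Matrix ι ι ℂ[T;T⁻¹]) : Prop :=
  ∀ j : ℤ, coeffMatrix P (-j) = (coeffMatrix P j)ᵀ

/-- The Laurent matrix polynomial `Q(λ + 1/λ)` obtained from a matrix polynomial `Q(y)`. -/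
def dicksonSubst (Q : Matrix ι ι ℂ[X]) : Matrix ι ι ℂ[T;T⁻¹] :=
  Q.map fun q =>
    Polynomial.aeval (LaurentPolynomial.T 1 + LaurentPolynomial.T (-1) : ℂ[T;T⁻¹]) q

/-- The identity `P(λ) = B(y) + w C(y)` of Laurent matrix polynomials in `λ`, where
`y = λ + 1/λ` and `w = λ - 1/λ`. -/
def IsSplitting (P : Matrix ι ι ℂ[T;T⁻¹]) (B C : Matrix ι ι ℂ[X]) : Prop :=
  P = dicksonSubst B +
    (LaurentPolynomial.T 1 - LaurentPolynomial.T (-1) : ℂ[T;T⁻¹]) • dicksonSubst C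

/-- The matrix polynomial `M(y) = [[B, w² C], [C, B]]` of doubled size, where `w² = y² - 4`. -/
def doubled (B C : Matrix ι ι ℂ[X]) : Matrix (ι ⊕ ι) (ι ⊕ ι) ℂ[X] :=
  Matrix.fromBlocks B ((Polynomial.X ^ 2 - 4 : ℂ[X]) • C) C B

end Polynomials

end PalindromicPencil

end

open PalindromicPencil

/-!
The Jordan structure of `F` at `z₀` is read off from a decreasing sequence of subspaces. Let
`leadSpace F z₀ m` consist of the values at `z₀` of the analytic vector functions `X` for which
`F X` vanishes at `z₀` to order at least `m`. By the Leibniz rule its nonzero elements are, for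
`m ≥ 1`, exactly the leading vectors of the Jordan chains of length `m`
(`IsJordanChain.mem_leadSpace`, `exists_isJordanChain`). Since a canonical system is chosen
greedily, the leading vectors of its chains of length at least `m` form a basis of
`leadSpace F z₀ m` (`IsCanonicalSystem.card_le_length`), so the dimensions of these spaces determine
the multiset of lengths (`hasJordanStructure_of_countP`). A canonical system exists as soon as
`leadSpace F z₀ N = 0` for some `N`, which holds when `det F` does not vanish identically near `z₀`
(`exists_leadSpace_eq_bot`).

The spaces `leadSpace` are invariant under local changes of the variable (`leadSpace_comp`), and
their dimensions are invariant under similarity by analytic invertible matrices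
(`finrank_leadSpace_le_of_mul_eq`) and additive over block diagonal matrices
(`finrank_leadSpace_fromBlocks`). As `z₀ ≠ ± 1`, the function `z ↦ z + z⁻¹` is a local change of the
variable at `z₀`, and `w = z - z⁻¹` does not vanish there, so that the matrix `[[w, -w], [1, 1]]`
conjugates `M(z + z⁻¹)` into `diag (B + w C, B - w C) = diag (P(z), P(z⁻¹))`. Hence the dimension
for `M` at `z₀ + z₀⁻¹` is the sum of those for `P` at `z₀` and at `z₀⁻¹`
(`finrank_leadSpace_doubled`). The palindromic symmetry is needed only for the eigenvalues: it gives
`P(z⁻¹) = P(z)ᵀ`, so that `det M(z + z⁻¹) = det P(z) ^ 2`.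

The splitting exists because `1` and `w` generate the Laurent polynomials over `ℂ[y]`
(`exists_splitting`); it is unique because `w` changes its sign under `z ↦ z⁻¹` while `y` does not
(`splitting_unique`).
-/

open scoped Matrix LaurentPolynomial Polynomial

namespace PalindromicPencil

open Filter Topology

/-! ### Vanishing orders of matrix-vector products -/

section Order

/-- Multiplication by an analytic factor does not decrease the order of vanishing. The function
`f` need not be analytic: its order is then `0`. -/
lemma le_analyticOrderAt_mul {g f : ℂ → ℂ} {z₀ : ℂ} {m : ℕ∞} (hg : AnalyticAt ℂ g z₀)
    (h : m ≤ analyticOrderAt f z₀) : m ≤ analyticOrderAt (fun z => g z * f z) z₀ := by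
  by_cases hf : AnalyticAt ℂ f z₀
  · have := analyticOrderAt_mul hg hf
    change m ≤ analyticOrderAt (g * f) z₀
    rw [this]
    exact h.trans le_add_self
  · rw [analyticOrderAt_of_not_analyticAt hf] at h
    exact h.trans zero_le

lemma le_analyticOrderAt_sum {κ : Type*} (s : Finset κ) {f : κ → ℂ → ℂ} {z₀ : ℂ} {m : ℕ∞}
    (h : ∀ k ∈ s, m ≤ analyticOrderAt (f k) z₀) :
    m ≤ analyticOrderAt (fun z => ∑ k ∈ s, f k z) z₀ := by
  classical
  induction s using Finset.induction_on with
  | empty =>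
    have : analyticOrderAt (fun _ : ℂ => (0 : ℂ)) z₀ = ⊤ :=
      analyticOrderAt_eq_top.mpr (Eventually.of_forall fun _ => rfl)
    simp [this]
  | insert a s ha ih =>
    simp only [Finset.sum_insert ha]
    exact (le_min (h a (by simp)) (ih fun k hk => h k (by simp [hk]))).trans
      le_analyticOrderAt_add

end Order

/-! ### Spaces of leading vectors -/

section LeadSpace

variable {ι κ : Type*} [Fintype ι]

/-- The matrix function `F` has analytic entries at `z₀`. -/
def IsAnalyticAt (F : ℂ → Matrix ι κ ℂ) (z₀ : ℂ) : Prop :=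
  ∀ a b, AnalyticAt ℂ (fun z => F z a b) z₀

lemma IsAnalyticAt.det [DecidableEq ι] {F : ℂ → Matrix ι ι ℂ} {z₀ : ℂ} (hF : IsAnalyticAt F z₀) :
    AnalyticAt ℂ (fun z => (F z).det) z₀ := by
  simp only [Matrix.det_apply']
  refine Finset.analyticAt_fun_sum _ fun σ _ => ?_
  exact analyticAt_const.mul (Finset.analyticAt_fun_prod _ fun i _ => hF _ _)

lemma IsAnalyticAt.adjugate [DecidableEq ι] {F : ℂ → Matrix ι ι ℂ} {z₀ : ℂ}
    (hF : IsAnalyticAt F z₀) : IsAnalyticAt (fun z => (F z).adjugate) z₀ := by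
  intro a b
  simp only [Matrix.adjugate_apply]
  refine IsAnalyticAt.det (F := fun z => (F z).updateRow b (Pi.single a 1)) fun i j => ?_
  simp only [Matrix.updateRow_apply]
  split_ifs
  · exact analyticAt_const
  · exact hF i j

/-- The values at `z₀` of the vector functions `X`, analytic at `z₀`, for which `F X` vanishes at
`z₀` to order at least `m`. For `m ≥ 1` the nonzero elements are the leading vectors of the Jordan
chains of length `m`. -/
def leadSpace (F : ℂ → Matrix κ ι ℂ) (z₀ : ℂ) (m : ℕ) : Submodule ℂ (ι → ℂ) where
  carrier := {v | ∃ X : ℂ → ι → ℂ, (∀ b, AnalyticAt ℂ (fun z => X z b) z₀) ∧ X z₀ = v ∧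
    ∀ a, (m : ℕ∞) ≤ analyticOrderAt (fun z => (F z *ᵥ X z) a) z₀}
  zero_mem' := ⟨fun _ => 0, fun _ => analyticAt_const, rfl, fun a => by
    have : analyticOrderAt (fun _ : ℂ => (0 : ℂ)) z₀ = ⊤ :=
      analyticOrderAt_eq_top.mpr (Eventually.of_forall fun _ => rfl)
    simp [this]⟩
  add_mem' := by
    rintro _ _ ⟨X, hX, rfl, hm⟩ ⟨Y, hY, rfl, hn⟩
    refine ⟨fun z => X z + Y z, fun b => (hX b).add (hY b), rfl, fun a => ?_⟩
    simp only [Matrix.mulVec_add, Pi.add_apply]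
    exact (le_min (hm a) (hn a)).trans le_analyticOrderAt_add
  smul_mem' := by
    rintro c _ ⟨X, hX, rfl, hm⟩
    refine ⟨fun z => c • X z, fun b => analyticAt_const.mul (hX b), rfl, fun a => ?_⟩
    simp only [Matrix.mulVec_smul, Pi.smul_apply, smul_eq_mul]
    exact le_analyticOrderAt_mul analyticAt_const (hm a)

lemma leadSpace_anti (F : ℂ → Matrix κ ι ℂ) (z₀ : ℂ) : Antitone (leadSpace F z₀) := by
  rintro m n hmn v ⟨X, hX, hv, h⟩
  exact ⟨X, hX, hv, fun a => (by exact_mod_cast hmn : (m : ℕ∞) ≤ n).trans (h a)⟩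

/-- If `det F` does not vanish identically near `z₀`, its order of vanishing bounds the lengths of
the Jordan chains, because `adj F · F X = (det F) X`. -/
lemma exists_leadSpace_eq_bot [DecidableEq ι] {F : ℂ → Matrix ι ι ℂ} {z₀ : ℂ}
    (hF : IsAnalyticAt F z₀) (hdet : analyticOrderAt (fun z => (F z).det) z₀ ≠ ⊤) :
    ∃ N, leadSpace F z₀ N = ⊥ := by
  obtain ⟨d, hd⟩ := ENat.ne_top_iff_exists.mp hdet
  refine ⟨d + 1, (Submodule.eq_bot_iff _).mpr ?_⟩
  rintro _ ⟨X, hX, rfl, hm⟩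
  ext b
  by_contra hb
  have key : ((d + 1 : ℕ) : ℕ∞) ≤ analyticOrderAt (fun z => (F z).det * X z b) z₀ := by
    have : (fun z => (F z).det * X z b) =
        fun z => ∑ a, (F z).adjugate b a * (F z *ᵥ X z) a := by
      ext z
      have := congrFun (Matrix.mulVec_mulVec (X z) (F z).adjugate (F z)) b
      rw [Matrix.adjugate_mul, Matrix.smul_mulVec, Matrix.one_mulVec] at this
      exact this.symm
    rw [this]
    exact le_analyticOrderAt_sum _ fun a _ => le_analyticOrderAt_mul (hF.adjugate b a) (hm a)
  have hmul := analyticOrderAt_mul hF.det (hX b)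
  have h0 : analyticOrderAt (fun z => X z b) z₀ = 0 :=
    (hX b).analyticOrderAt_eq_zero.mpr hb
  change _ ≤ analyticOrderAt ((fun z => (F z).det) * fun z => X z b) z₀ at key
  rw [hmul, h0, ← hd, add_zero] at key
  have : d + 1 ≤ d := by exact_mod_cast key
  omega

/-! ### Invariance of the spaces of leading vectors -/

/-- Left and right analytic factors: if `F E = E' G` near `z₀`, then `E z₀` carries leading
vectors of `G` to leading vectors of `F`. -/
lemma mulVec_mem_leadSpace {ι' κ' : Type*} [Fintype ι'] [Fintype κ']
    {F : ℂ → Matrix κ ι ℂ} {G : ℂ → Matrix κ' ι' ℂ} {E : ℂ → Matrix ι ι' ℂ}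
    {E' : ℂ → Matrix κ κ' ℂ} {z₀ : ℂ} {m : ℕ} (hE : IsAnalyticAt E z₀) (hE' : IsAnalyticAt E' z₀)
    (h : ∀ᶠ z in 𝓝 z₀, F z * E z = E' z * G z) {v : ι' → ℂ} (hv : v ∈ leadSpace G z₀ m) :
    E z₀ *ᵥ v ∈ leadSpace F z₀ m := by
  obtain ⟨X, hX, rfl, hm⟩ := hv
  refine ⟨fun z => E z *ᵥ X z, fun b => ?_, rfl, fun a => ?_⟩
  · exact Finset.analyticAt_fun_sum _ fun i _ => (hE b i).mul (hX i)
  · have : (fun z => (F z *ᵥ E z *ᵥ X z) a) =ᶠ[𝓝 z₀]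
        fun z => ∑ i, E' z a i * (G z *ᵥ X z) i := by
      filter_upwards [h] with z hz
      rw [Matrix.mulVec_mulVec, hz, ← Matrix.mulVec_mulVec]
      rfl
    rw [analyticOrderAt_congr this]
    exact le_analyticOrderAt_sum _ fun i _ => le_analyticOrderAt_mul (hE' a i) (hm i)

lemma leadSpace_congr {F G : ℂ → Matrix κ ι ℂ} {z₀ : ℂ} (h : F =ᶠ[𝓝 z₀] G) (m : ℕ) :
    leadSpace F z₀ m = leadSpace G z₀ m := by
  ext v
  refine exists_congr fun X => and_congr_right fun _ => and_congr_right fun _ =>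
    forall_congr' fun a => ?_
  have : (fun z => (F z *ᵥ X z) a) =ᶠ[𝓝 z₀] fun z => (G z *ᵥ X z) a :=
    h.mono fun z hz => by simp only [hz]
  rw [analyticOrderAt_congr this]

lemma leadSpace_le_comp {F : ℂ → Matrix κ ι ℂ} {φ : ℂ → ℂ} {a b : ℂ}
    (hφ : AnalyticAt ℂ φ a) (hab : φ a = b) (hφ' : deriv φ a ≠ 0) (m : ℕ) :
    leadSpace F b m ≤ leadSpace (fun z => F (φ z)) a m := by
  subst hab
  rintro _ ⟨X, hX, rfl, hm⟩
  refine ⟨fun z => X (φ z), fun i => (hX i).comp hφ, rfl, fun i => ?_⟩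
  exact (hm i).trans_eq (analyticOrderAt_comp_of_deriv_ne_zero hφ hφ').symm

/-- A local change of the variable preserves the spaces of leading vectors. -/
lemma leadSpace_comp {F : ℂ → Matrix κ ι ℂ} {φ : ℂ → ℂ} {a b : ℂ}
    (hφ : AnalyticAt ℂ φ a) (hab : φ a = b) (hφ' : deriv φ a ≠ 0) (m : ℕ) :
    leadSpace (fun z => F (φ z)) a m = leadSpace F b m := by
  refine le_antisymm ?_ (leadSpace_le_comp hφ hab hφ' m)
  subst hab
  set ψ := hφ.hasStrictDerivAt.localInverse _ _ _ hφ' with hψ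
  have hψa : ψ (φ a) = a := HasStrictFDerivAt.localInverse_apply_image ..
  have hd : deriv ψ (φ a) ≠ 0 := by
    rw [(hφ.hasStrictDerivAt.to_localInverse hφ').hasDerivAt.deriv]
    exact inv_ne_zero hφ'
  refine (leadSpace_le_comp (hφ.analyticAt_localInverse hφ') hψa hd m).trans_eq ?_
  refine leadSpace_congr ?_ m
  filter_upwards [hφ.hasStrictDerivAt.eventually_right_inverse hφ'] with z hz
  rw [hz]

lemma mem_leadSpace_fromBlocks {ι' : Type*} [Fintype ι'] {F : ℂ → Matrix ι ι ℂ}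
    {G : ℂ → Matrix ι' ι' ℂ} {z₀ : ℂ} {m : ℕ} {v : ι ⊕ ι' → ℂ} :
    v ∈ leadSpace (fun z => Matrix.fromBlocks (F z) 0 0 (G z)) z₀ m ↔
      v ∘ Sum.inl ∈ leadSpace F z₀ m ∧ v ∘ Sum.inr ∈ leadSpace G z₀ m := by
  constructor
  · rintro ⟨X, hX, rfl, hm⟩
    refine ⟨⟨fun z => X z ∘ Sum.inl, fun b => hX (Sum.inl b), rfl, fun a => ?_⟩,
      ⟨fun z => X z ∘ Sum.inr, fun b => hX (Sum.inr b), rfl, fun a => ?_⟩⟩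
    · simpa [Matrix.fromBlocks_mulVec] using hm (Sum.inl a)
    · simpa [Matrix.fromBlocks_mulVec] using hm (Sum.inr a)
  · rintro ⟨⟨X, hX, hXv, hm⟩, ⟨Y, hY, hYv, hn⟩⟩
    refine ⟨fun z => Sum.elim (X z) (Y z), Sum.rec hX hY, ?_, Sum.rec (fun a => ?_) fun a => ?_⟩
    · simp only [hXv, hYv, Sum.elim_comp_inl_inr]
    · simpa [Matrix.fromBlocks_mulVec] using hm a
    · simpa [Matrix.fromBlocks_mulVec] using hn a

lemma finrank_leadSpace_fromBlocks {ι' : Type*} [Fintype ι'] (F : ℂ → Matrix ι ι ℂ)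
    (G : ℂ → Matrix ι' ι' ℂ) (z₀ : ℂ) (m : ℕ) :
    Module.finrank ℂ (leadSpace (fun z => Matrix.fromBlocks (F z) 0 0 (G z)) z₀ m) =
      Module.finrank ℂ (leadSpace F z₀ m) + Module.finrank ℂ (leadSpace G z₀ m) := by
  have h : (leadSpace (fun z => Matrix.fromBlocks (F z) 0 0 (G z)) z₀ m).map
      (LinearEquiv.sumArrowLequivProdArrow ι ι' ℂ ℂ).toLinearMap =
      (leadSpace F z₀ m).prod (leadSpace G z₀ m) := by
    ext ⟨x, y⟩
    rw [Submodule.mem_map_equiv, mem_leadSpace_fromBlocks]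
    rfl
  have hp : Module.finrank ℂ ((leadSpace F z₀ m).prod (leadSpace G z₀ m)) =
      Module.finrank ℂ (leadSpace F z₀ m × leadSpace G z₀ m) := by
    rw [← LinearMap.finrank_range_of_inj (f := (leadSpace F z₀ m).subtype.prodMap
      (leadSpace G z₀ m).subtype) (Subtype.val_injective.prodMap Subtype.val_injective),
      LinearMap.range_prodMap, Submodule.range_subtype, Submodule.range_subtype]
  rw [← Module.finrank_prod, ← hp, ← h, LinearEquiv.finrank_map_eq]

end LeadSpace

/-! ### Jordan chains and canonical systems -/

section Canonical

variable {ι : Type*} [Fintype ι] {F : ℂ → Matrix ι ι ℂ} {z₀ : ℂ}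

/-- The coefficients in the definition of a Jordan chain are the Taylor coefficients of `F X`
when the vectors of the chain are the Taylor coefficients of `X`. -/
lemma iteratedDeriv_mulVec (hF : IsAnalyticAt F z₀) {X : ℂ → ι → ℂ}
    (hX : ∀ b, AnalyticAt ℂ (fun z => X z b) z₀) {x : ℕ → ι → ℂ} {m : ℕ}
    (hx : ∀ i ≤ m, ∀ b, iteratedDeriv i (fun z => X z b) z₀ = i.factorial * x i b) (a : ι) :
    iteratedDeriv m (fun z => (F z *ᵥ X z) a) z₀ = m.factorial *
      (∑ i ∈ Finset.range (m + 1),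
        (((m - i).factorial : ℂ)⁻¹ • matrixDeriv F (m - i) z₀) *ᵥ x i) a := by
  have h1 : (fun z => (F z *ᵥ X z) a) = fun z => ∑ b, X z b * F z a b := by
    ext z; simp [Matrix.mulVec, dotProduct, mul_comm]
  have hXF : ∀ b, AnalyticAt ℂ (fun z => X z b * F z a b) z₀ := fun b => (hX b).mul (hF a b)
  rw [h1, iteratedDeriv_fun_sum fun b _ => (hXF b).contDiffAt, Finset.sum_apply, Finset.mul_sum]
  have h2 : ∀ b, iteratedDeriv m (fun z => X z b * F z a b) z₀ =
      ∑ i ∈ Finset.range (m + 1), (m.choose i : ℂ) * iteratedDeriv i (fun z => X z b) z₀ *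
        iteratedDeriv (m - i) (fun z => F z a b) z₀ := fun b =>
    iteratedDeriv_mul (hX b).contDiffAt (hF a b).contDiffAt
  simp only [h2]
  rw [Finset.sum_comm]
  refine Finset.sum_congr rfl fun i hi => ?_
  have him : i ≤ m := by simpa [Nat.lt_succ_iff] using hi
  simp only [Matrix.mulVec, dotProduct, Finset.mul_sum, Matrix.smul_apply, matrixDeriv,
    Matrix.of_apply, smul_eq_mul]
  refine Finset.sum_congr rfl fun b _ => ?_
  rw [hx i him b, ← Nat.choose_mul_factorial_mul_factorial him]
  have : ((m - i).factorial : ℂ) ≠ 0 := by exact_mod_cast Nat.factorial_ne_zero _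
  push_cast
  field_simp

lemma IsJordanChain.mem_leadSpace (hF : IsAnalyticAt F z₀) {m : ℕ} {x : ℕ → ι → ℂ}
    (h : IsJordanChain F z₀ m x) : x 0 ∈ leadSpace F z₀ m := by
  obtain ⟨hm, -, hx⟩ := h
  -- the vector polynomial with Taylor coefficients `x 0, …, x (m - 1)`
  set X : ℂ → ι → ℂ := fun z b => ∑ i ∈ Finset.range m, (z - z₀) ^ i * x i b with hXdef
  have hX : ∀ b, AnalyticAt ℂ (fun z => X z b) z₀ := fun b => by fun_prop
  have hXd : ∀ i < m, ∀ b, iteratedDeriv i (fun z => X z b) z₀ = i.factorial * x i b := by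
    intro i hi b
    have hc := congrFun (iteratedDeriv_comp_sub_const i
      (fun u : ℂ => ∑ i ∈ Finset.range m, u ^ i * x i b) z₀) z₀
    simp only [sub_self] at hc
    refine hc.trans ?_
    rw [iteratedDeriv_fun_sum fun j _ => by fun_prop]
    rw [Finset.sum_eq_single_of_mem i (by simpa using hi)]
    · rw [iteratedDeriv_mul_const_field, iteratedDeriv_fun_pow_zero]; simp
    · intro j _ hj
      rw [iteratedDeriv_mul_const_field, iteratedDeriv_fun_pow_zero]
      simp [hj.symm]
  refine ⟨X, hX, ?_, fun a => ?_⟩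
  · ext b
    simpa using hXd 0 hm b
  · have hFX : AnalyticAt ℂ (fun z => (F z *ᵥ X z) a) z₀ :=
      Finset.analyticAt_fun_sum _ fun i _ => (hF a i).mul (hX i)
    rw [natCast_le_analyticOrderAt_iff_iteratedDeriv_eq_zero hFX]
    intro i hi
    rw [iteratedDeriv_mulVec hF hX (x := x) (fun j hj b => hXd j (by omega) b), hx i hi]
    simp

lemma exists_isJordanChain (hF : IsAnalyticAt F z₀) {m : ℕ} (hm : 0 < m) {v : ι → ℂ}
    (hv : v ∈ leadSpace F z₀ m) (hv0 : v ≠ 0) : ∃ x, IsJordanChain F z₀ m x ∧ x 0 = v := by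
  obtain ⟨X, hX, rfl, hX0⟩ := hv
  refine ⟨fun i b => (i.factorial : ℂ)⁻¹ * iteratedDeriv i (fun z => X z b) z₀,
    ⟨hm, ?_, fun k hk => ?_⟩, ?_⟩
  · simpa using hv0
  · ext a
    have hFX : AnalyticAt ℂ (fun z => (F z *ᵥ X z) a) z₀ :=
      Finset.analyticAt_fun_sum _ fun i _ => (hF a i).mul (hX i)
    have h := (natCast_le_analyticOrderAt_iff_iteratedDeriv_eq_zero hFX).mp (hX0 a) k hk
    have hfac : ∀ i : ℕ, (i.factorial : ℂ) ≠ 0 := fun i => by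
      exact_mod_cast Nat.factorial_ne_zero _
    rw [iteratedDeriv_mulVec hF hX
      (x := fun i b => (i.factorial : ℂ)⁻¹ * iteratedDeriv i (fun z => X z b) z₀)
      (fun i _ b => by field_simp [hfac i])] at h
    exact (mul_eq_zero.mp h).resolve_left (hfac k)
  · ext b; simp

lemma leadSpace_one (hF : IsAnalyticAt F z₀) :
    leadSpace F z₀ 1 = LinearMap.ker (F z₀).mulVecLin := by
  ext v
  rw [LinearMap.mem_ker, Matrix.mulVecLin_apply]
  have key : ∀ X : ℂ → ι → ℂ, (∀ b, AnalyticAt ℂ (fun z => X z b) z₀) → ∀ a,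
      (((1 : ℕ) : ℕ∞) ≤ analyticOrderAt (fun z => (F z *ᵥ X z) a) z₀ ↔
        (F z₀ *ᵥ X z₀) a = 0) := fun X hX a => by
    have hFX : AnalyticAt ℂ (fun z => (F z *ᵥ X z) a) z₀ :=
      Finset.analyticAt_fun_sum _ fun i _ => (hF a i).mul (hX i)
    rw [natCast_le_analyticOrderAt_iff_iteratedDeriv_eq_zero hFX]
    simp
  constructor
  · rintro ⟨X, hX, rfl, hm⟩
    exact funext fun a => (key X hX a).mp (hm a)
  · intro hv
    have hX : ∀ b, AnalyticAt ℂ (fun _ : ℂ => v b) z₀ := fun b => analyticAt_const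
    exact ⟨fun _ => v, hX, rfl, fun a => (key (fun _ => v) hX a).mpr (congrFun hv a)⟩

lemma linearIndependent_of_notMem_span {V : Type*} [AddCommGroup V] [Module ℂ V] {r : ℕ}
    {u : Fin r → V} (h : ∀ i, u i ∉ Submodule.span ℂ (u '' {j | j < i})) :
    LinearIndependent ℂ u := by
  induction r with
  | zero => exact linearIndependent_empty_type
  | succ r ih =>
    rw [linearIndependent_finSucc']
    refine ⟨ih fun i hi => h i.castSucc ?_, fun hl => h (Fin.last r) ?_⟩
    · refine Submodule.span_mono ?_ hi
      rintro _ ⟨j, hj, rfl⟩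
      exact ⟨j.castSucc, by simpa using hj, rfl⟩
    · refine Submodule.span_mono ?_ hl
      rintro _ ⟨j, rfl⟩
      exact ⟨j.castSucc, Fin.castSucc_lt_last j, rfl⟩

/-- The leading vectors of the chains of length at least `m` in a canonical system form a basis of
`leadSpace F z₀ m`: by the greedy choice these chains come first, and every vector of
`leadSpace F z₀ m` outside their span would have been preferred to the next chain. -/
lemma IsCanonicalSystem.card_le_length (hF : IsAnalyticAt F z₀) {r : ℕ} {ℓ : Fin r → ℕ}
    {x : Fin r → ℕ → ι → ℂ} (h : IsCanonicalSystem F z₀ r ℓ x) {m : ℕ} (hm : 0 < m) :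
    (Finset.univ.filter fun i => m ≤ ℓ i).card = Module.finrank ℂ (leadSpace F z₀ m) := by
  have hli : LinearIndependent ℂ fun i => x i 0 := linearIndependent_of_notMem_span h.notMem_span
  have hspan : Submodule.span ℂ (Set.range fun i : {i // m ≤ ℓ i} => x i 0) =
      leadSpace F z₀ m := by
    refine le_antisymm (Submodule.span_le.mpr ?_) fun v hv => ?_
    · rintro _ ⟨⟨i, hi⟩, rfl⟩
      exact leadSpace_anti F z₀ hi ((h.chain i).mem_leadSpace hF)
    · by_contra hvn
      have hv0 : v ≠ 0 := fun h0 => hvn (h0 ▸ Submodule.zero_mem _)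
      obtain ⟨y, hy, rfl⟩ := exists_isJordanChain hF hm hv hv0
      by_cases hall : ∀ i, m ≤ ℓ i
      · have hker : y 0 ∈ LinearMap.ker (F z₀).mulVecLin :=
          leadSpace_one hF ▸ leadSpace_anti F z₀ hm hv
        rw [← h.span_eq] at hker
        refine hvn (Submodule.span_mono ?_ hker)
        rintro _ ⟨i, rfl⟩
        exact ⟨⟨i, hall i⟩, rfl⟩
      · push Not at hall
        -- the first chain shorter than `m` contradicts maximality
        obtain ⟨i, hi, hmin⟩ := WellFounded.has_min (wellFounded_lt (α := Fin r))
          {i | ℓ i < m} hall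
        refine (h.maximal i m y hy fun hmem => hvn (Submodule.span_mono ?_ hmem)).not_gt hi
        rintro _ ⟨j, hj, rfl⟩
        exact ⟨⟨j, not_lt.mp fun hjm => hmin j hjm hj⟩, rfl⟩
  have hli' : LinearIndependent ℂ fun i : {i // m ≤ ℓ i} => x i 0 :=
    hli.comp _ Subtype.val_injective
  rw [← hspan, finrank_span_eq_card hli', Fintype.card_subtype]

/-- The greedy choice of `r` chains either stops at a canonical system or goes on. -/
lemma exists_isCanonicalSystem_or (hF : IsAnalyticAt F z₀) {N : ℕ} (hN : leadSpace F z₀ N = ⊥)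
    (r : ℕ) : (∃ (s : ℕ) (ℓ : Fin s → ℕ) (x : Fin s → ℕ → ι → ℂ), IsCanonicalSystem F z₀ s ℓ x) ∨
      ∃ (ℓ : Fin r → ℕ) (x : Fin r → ℕ → ι → ℂ), (∀ i, IsJordanChain F z₀ (ℓ i) (x i)) ∧
        (∀ i, x i 0 ∉ Submodule.span ℂ ((fun j => x j 0) '' {j | j < i})) ∧
        ∀ i (m : ℕ) (v : ℕ → ι → ℂ), IsJordanChain F z₀ m v →
          v 0 ∉ Submodule.span ℂ ((fun j => x j 0) '' {j | j < i}) → m ≤ ℓ i := by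
  classical
  induction r with
  | zero => exact Or.inr ⟨Fin.elim0, Fin.elim0, fun i => i.elim0, fun i => i.elim0,
      fun i => i.elim0⟩
  | succ r ih =>
    obtain hc | ⟨ℓ, x, hch, hns, hmax⟩ := ih
    · exact Or.inl hc
    have hle : Submodule.span ℂ (Set.range fun j => x j 0) ≤
        LinearMap.ker (F z₀).mulVecLin := by
      rw [← leadSpace_one hF]
      refine Submodule.span_le.mpr ?_
      rintro _ ⟨i, rfl⟩
      exact leadSpace_anti F z₀ (hch i).1 ((hch i).mem_leadSpace hF)
    by_cases heq : Submodule.span ℂ (Set.range fun j => x j 0) = LinearMap.ker (F z₀).mulVecLin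
    · exact Or.inl ⟨r, ℓ, x, hch, hns, hmax, heq⟩
    obtain ⟨v, hv, hvn⟩ := SetLike.exists_of_lt (lt_of_le_of_ne hle heq)
    -- the lengths of the chains that may be appended
    let p : ℕ → Prop := fun m => ∃ y, IsJordanChain F z₀ m y ∧
      y 0 ∉ Submodule.span ℂ (Set.range fun j => x j 0)
    have hp1 : p 1 := by
      have hv0 : v ≠ 0 := fun h0 => hvn (h0 ▸ Submodule.zero_mem _)
      obtain ⟨y, hy, rfl⟩ := exists_isJordanChain hF one_pos (leadSpace_one hF ▸ hv) hv0
      exact ⟨y, hy, hvn⟩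
    have hpN : ∀ m, p m → m ≤ N := by
      rintro m ⟨y, hy, -⟩
      by_contra hmN
      have := leadSpace_anti F z₀ (not_le.mp hmN).le (hy.mem_leadSpace hF)
      rw [hN] at this
      exact hy.2.1 this
    obtain ⟨y, hy, hyn⟩ : p (Nat.findGreatest p N) := Nat.findGreatest_spec (hpN 1 hp1) hp1
    have himg : ∀ (i : Fin r), (fun j => (Fin.snoc x y : Fin (r + 1) → ℕ → ι → ℂ) j 0) ''
        {j | j < i.castSucc} = (fun j => x j 0) '' {j | j < i} := by
      intro i
      ext u
      constructor
      · rintro ⟨j, hj, rfl⟩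
        induction j using Fin.lastCases with
        | last => exact absurd hj (not_lt.mpr (Fin.le_last _))
        | cast j => exact ⟨j, by simpa using hj, by simp⟩
      · rintro ⟨j, hj, rfl⟩
        exact ⟨j.castSucc, by simpa using hj, by simp⟩
    have himgl : (fun j => (Fin.snoc x y : Fin (r + 1) → ℕ → ι → ℂ) j 0) ''
        {j | j < Fin.last r} = Set.range fun j => x j 0 := by
      ext u
      constructor
      · rintro ⟨j, hj, rfl⟩
        induction j using Fin.lastCases with
        | last => exact absurd hj (lt_irrefl (Fin.last r))
        | cast j => exact ⟨j, by simp⟩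
      · rintro ⟨j, rfl⟩
        exact ⟨j.castSucc, Fin.castSucc_lt_last j, by simp⟩
    refine Or.inr ⟨Fin.snoc ℓ (Nat.findGreatest p N), Fin.snoc x y, fun i => ?_, fun i => ?_,
      fun i => ?_⟩
    · induction i using Fin.lastCases with
      | last => simpa using hy
      | cast i => simpa using hch i
    · induction i using Fin.lastCases with
      | last => rw [himgl]; simpa using hyn
      | cast i => rw [himg]; simpa using hns i
    · induction i using Fin.lastCases with
      | last =>
        rw [himgl]
        intro m w hw hwn
        rw [Fin.snoc_last]
        exact Nat.le_findGreatest (hpN m ⟨w, hw, hwn⟩) ⟨w, hw, hwn⟩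
      | cast i => rw [himg, Fin.snoc_castSucc]; exact hmax i

lemma exists_isCanonicalSystem (hF : IsAnalyticAt F z₀) {N : ℕ} (hN : leadSpace F z₀ N = ⊥) :
    ∃ (r : ℕ) (ℓ : Fin r → ℕ) (x : Fin r → ℕ → ι → ℂ), IsCanonicalSystem F z₀ r ℓ x := by
  obtain h | ⟨ℓ, x, -, hns, -⟩ := exists_isCanonicalSystem_or hF hN (Fintype.card ι + 1)
  · exact h
  · -- leading vectors are linearly independent, so there are at most `card ι` of them
    have := (linearIndependent_of_notMem_span hns).fintype_card_le_finrank
    simp at this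

/-- A multiset of positive integers is determined by the numbers of its elements that are at
least `m`, for `m ≥ 1`. -/
lemma multiset_eq_of_countP_eq {σ τ : Multiset ℕ} (hσ : 0 ∉ σ) (hτ : 0 ∉ τ)
    (h : ∀ m, 0 < m → σ.countP (m ≤ ·) = τ.countP (m ≤ ·)) : σ = τ := by
  have split : ∀ (ρ : Multiset ℕ) (m : ℕ),
      ρ.countP (m ≤ ·) = ρ.count m + ρ.countP (m + 1 ≤ ·) := by
    intro ρ m
    induction ρ using Multiset.induction_on with
    | empty => simp
    | cons a ρ ih =>
      simp only [Multiset.countP_cons, Multiset.count_cons, ih]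
      split_ifs <;> omega
  ext m
  rcases Nat.eq_zero_or_pos m with rfl | hm
  · rw [Multiset.count_eq_zero.mpr hσ, Multiset.count_eq_zero.mpr hτ]
  · have h1 := split σ m
    have h2 := split τ m
    have h3 := h m hm
    have h4 := h (m + 1) m.succ_pos
    omega

/-- The Jordan structure is the multiset of positive integers that has, for each `m ≥ 1`,
exactly `dim (leadSpace F z₀ m)` elements `≥ m`. -/
lemma hasJordanStructure_of_countP (hF : IsAnalyticAt F z₀) {N : ℕ}
    (hN : leadSpace F z₀ N = ⊥) {σ : Multiset ℕ} (hσ : 0 ∉ σ)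
    (h : ∀ m, 0 < m → σ.countP (m ≤ ·) = Module.finrank ℂ (leadSpace F z₀ m)) :
    HasJordanStructure F z₀ σ := by
  refine ⟨exists_isCanonicalSystem hF hN, fun r ℓ x hc => ?_⟩
  refine multiset_eq_of_countP_eq ?_ hσ fun m hm => ?_
  · intro h0
    obtain ⟨i, -, hi⟩ := Multiset.mem_map.mp h0
    exact (hc.chain i).1.ne' hi
  · rw [h m hm, ← hc.card_le_length hF hm, Multiset.countP_map]
    rfl

lemma exists_hasJordanStructure (hF : IsAnalyticAt F z₀) {N : ℕ} (hN : leadSpace F z₀ N = ⊥) :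
    ∃ σ : Multiset ℕ, HasJordanStructure F z₀ σ ∧ 0 ∉ σ ∧
      ∀ m, 0 < m → σ.countP (m ≤ ·) = Module.finrank ℂ (leadSpace F z₀ m) := by
  obtain ⟨r, ℓ, x, hc⟩ := exists_isCanonicalSystem hF hN
  have h0 : 0 ∉ Finset.univ.val.map ℓ := fun h0 => by
    obtain ⟨i, -, hi⟩ := Multiset.mem_map.mp h0
    exact (hc.chain i).1.ne' hi
  have hcount : ∀ m, 0 < m → (Finset.univ.val.map ℓ).countP (m ≤ ·) =
      Module.finrank ℂ (leadSpace F z₀ m) := fun m hm => by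
    rw [← hc.card_le_length hF hm, Multiset.countP_map]
    rfl
  exact ⟨_, hasJordanStructure_of_countP hF hN h0 hcount, h0, hcount⟩

end Canonical

/-! ### Evaluation of Laurent polynomials -/

section Eval

lemma coeff_sum_eq_eval₂ {z : ℂ} (hz : z ≠ 0) (p : ℂ[T;T⁻¹]) :
    (p.coeff.sum fun j a => a * z ^ j) =
      LaurentPolynomial.eval₂ (RingHom.id ℂ) (Units.mk0 z hz) p := by
  induction p using LaurentPolynomial.induction_on' with
  | add p q hp hq =>
    rw [map_add, ← hp, ← hq, AddMonoidAlgebra.coeff_add,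
      Finsupp.sum_add_index' (by simp) (by intros; ring)]
  | C_mul_T n a =>
    rw [LaurentPolynomial.eval₂_C_mul_T, ← LaurentPolynomial.single_eq_C_mul_T,
      AddMonoidAlgebra.coeff_single, Finsupp.sum_single_index (by simp)]
    simp

lemma laurentFun_eq_map {ι : Type*} (P : Matrix ι ι ℂ[T;T⁻¹]) {z : ℂ} (hz : z ≠ 0) :
    laurentFun P z = P.map (LaurentPolynomial.eval₂ (RingHom.id ℂ) (Units.mk0 z hz)) := by
  ext a b
  exact coeff_sum_eq_eval₂ hz (P a b)

lemma det_laurentFun {ι : Type*} [Fintype ι] [DecidableEq ι] (P : Matrix ι ι ℂ[T;T⁻¹]) {z : ℂ}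
    (hz : z ≠ 0) : (laurentFun P z).det =
      LaurentPolynomial.eval₂ (RingHom.id ℂ) (Units.mk0 z hz) P.det := by
  rw [laurentFun_eq_map P hz, RingHom.map_det]
  rfl

lemma isAnalyticAt_laurentFun {ι : Type*} (P : Matrix ι ι ℂ[T;T⁻¹]) {z₀ : ℂ} (hz : z₀ ≠ 0) :
    IsAnalyticAt (laurentFun P) z₀ := fun _ _ =>
  Finset.analyticAt_fun_sum _ fun _ _ => analyticAt_const.mul (analyticAt_id.zpow hz)

lemma isAnalyticAt_polyFun {ι : Type*} (Q : Matrix ι ι ℂ[X]) (y : ℂ) :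
    IsAnalyticAt (polyFun Q) y := fun a b => by
  have := (AnalyticAt.aeval_polynomial (𝕜 := ℂ) (analyticAt_id (𝕜 := ℂ) (z := y)) (Q a b))
  simpa [polyFun] using this

/-- The determinant of a regular Laurent matrix polynomial does not vanish identically near a
nonzero point. -/
lemma analyticOrderAt_det_laurentFun_ne_top {ι : Type*} [Fintype ι] [DecidableEq ι]
    {P : Matrix ι ι ℂ[T;T⁻¹]} (hreg : P.det ≠ 0) {z₀ : ℂ} (hz : z₀ ≠ 0) :
    analyticOrderAt (fun z => (laurentFun P z).det) z₀ ≠ ⊤ := by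
  rw [Ne, analyticOrderAt_eq_top]
  intro h
  obtain ⟨k, q, hq⟩ := LaurentPolynomial.exists_T_pow P.det
  have hq0 : q ≠ 0 := by
    rintro rfl
    rw [map_zero] at hq
    exact hreg ((LaurentPolynomial.isUnit_T (R := ℂ) (k : ℤ)).mul_left_eq_zero.mp hq.symm)
  refine hq0 (Polynomial.eq_zero_of_infinite_isRoot q ?_)
  refine infinite_of_mem_nhds z₀ ?_
  filter_upwards [h, isOpen_ne.mem_nhds hz] with z hdet hz0
  have := congrArg (LaurentPolynomial.eval₂ (RingHom.id ℂ) (Units.mk0 z hz0)) hq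
  rw [map_mul, ← det_laurentFun P hz0, hdet, zero_mul, LaurentPolynomial.eval₂_toLaurent,
    Polynomial.eval₂_id] at this
  exact this

lemma laurentFun_inv_of_isTPalindromic {ι : Type*} {P : Matrix ι ι ℂ[T;T⁻¹]}
    (hpal : IsTPalindromic P) {z : ℂ} (hz : z ≠ 0) :
    laurentFun P z⁻¹ = (laurentFun P z)ᵀ := by
  have hinv : ∀ p : ℂ[T;T⁻¹],
      LaurentPolynomial.eval₂ (RingHom.id ℂ) (Units.mk0 z⁻¹ (inv_ne_zero hz)) p =
      LaurentPolynomial.eval₂ (RingHom.id ℂ) (Units.mk0 z hz) (LaurentPolynomial.invert p) := by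
    intro p
    induction p using LaurentPolynomial.induction_on' with
    | add p q hp hq => simp only [map_add, hp, hq]
    | C_mul_T n a => simp
  ext a b
  rw [laurentFun_eq_map P hz, laurentFun_eq_map P (inv_ne_zero hz), Matrix.map_apply, hinv,
    Matrix.transpose_apply, Matrix.map_apply]
  congr 1
  ext j
  rw [LaurentPolynomial.invert_apply]
  exact congrFun (congrFun (hpal j) a) b

end Eval

/-! ### The splitting `P = B(y) + w C(y)` -/

section Splitting

open LaurentPolynomial in
/-- `1` and `w` generate the Laurent polynomials over `ℂ[y]`: multiplication by
`λ = (y + w) / 2` and by `λ⁻¹ = (y - w) / 2` preserves `ℂ[y] + w ℂ[y]`, because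
`w ^ 2 = y ^ 2 - 4`. -/
lemma exists_splitting (p : ℂ[T;T⁻¹]) : ∃ b c : ℂ[X],
    p = Polynomial.aeval (T 1 + T (-1) : ℂ[T;T⁻¹]) b +
      (T 1 - T (-1)) * Polynomial.aeval (T 1 + T (-1) : ℂ[T;T⁻¹]) c := by
  have hT : (T 1 * T (-1) : ℂ[T;T⁻¹]) = 1 := by rw [← T_add]; simp
  have hhalf : (2 : ℂ[T;T⁻¹]) * algebraMap ℂ ℂ[T;T⁻¹] 2⁻¹ = 1 := by
    rw [← map_ofNat (algebraMap ℂ ℂ[T;T⁻¹]) 2, ← map_mul]; simp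
  induction p using LaurentPolynomial.induction_on with
  | h_C a => exact ⟨Polynomial.C a, 0, by simp⟩
  | h_add hp hq =>
    obtain ⟨b, c, rfl⟩ := hp
    obtain ⟨b', c', rfl⟩ := hq
    exact ⟨b + b', c + c', by simp only [map_add]; ring⟩
  | h_C_mul_T n a h =>
    obtain ⟨b, c, h⟩ := h
    refine ⟨Polynomial.C 2⁻¹ * (Polynomial.X * b + (Polynomial.X ^ 2 - 4) * c),
      Polynomial.C 2⁻¹ * (b + Polynomial.X * c), ?_⟩
    rw [T_add, ← mul_assoc, h]
    simp only [map_mul, map_add, map_sub, map_pow, Polynomial.aeval_X, Polynomial.aeval_C,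
      map_ofNat]
    linear_combination -4 * algebraMap ℂ ℂ[T;T⁻¹] 2⁻¹ * Polynomial.aeval (T 1 + T (-1) : ℂ[T;T⁻¹]) c * hT -
      (Polynomial.aeval (T 1 + T (-1) : ℂ[T;T⁻¹]) b +
        (T 1 - T (-1)) * Polynomial.aeval (T 1 + T (-1) : ℂ[T;T⁻¹]) c) * T 1 * hhalf
  | h_C_mul_T_Z n a h =>
    obtain ⟨b, c, h⟩ := h
    refine ⟨Polynomial.C 2⁻¹ * (Polynomial.X * b - (Polynomial.X ^ 2 - 4) * c),
      Polynomial.C 2⁻¹ * (Polynomial.X * c - b), ?_⟩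
    rw [T_sub, ← mul_assoc, h]
    simp only [map_mul, map_sub, map_pow, Polynomial.aeval_X, Polynomial.aeval_C,
      map_ofNat]
    linear_combination 4 * algebraMap ℂ ℂ[T;T⁻¹] 2⁻¹ * Polynomial.aeval (T 1 + T (-1) : ℂ[T;T⁻¹]) c * hT -
      (Polynomial.aeval (T 1 + T (-1) : ℂ[T;T⁻¹]) b +
        (T 1 - T (-1)) * Polynomial.aeval (T 1 + T (-1) : ℂ[T;T⁻¹]) c) * T (-1) * hhalf

lemma eval₂_aeval {z : ℂ} (hz : z ≠ 0) (q : ℂ[X]) :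
    LaurentPolynomial.eval₂ (RingHom.id ℂ) (Units.mk0 z hz) (Polynomial.aeval
      (LaurentPolynomial.T 1 + LaurentPolynomial.T (-1) : ℂ[T;T⁻¹]) q) = q.eval (z + z⁻¹) := by
  induction q using Polynomial.induction_on' with
  | add p q hp hq => simp only [map_add, hp, hq, Polynomial.eval_add]
  | monomial n a =>
    simp [← LaurentPolynomial.C_eq_algebraMap, Polynomial.aeval_monomial]

/-- The values of `P` in terms of a splitting. -/
lemma IsSplitting.laurentFun_eq {ι : Type*} {P : Matrix ι ι ℂ[T;T⁻¹]} {B C : Matrix ι ι ℂ[X]}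
    (h : IsSplitting P B C) {z : ℂ} (hz : z ≠ 0) :
    laurentFun P z = polyFun B (z + z⁻¹) + (z - z⁻¹) • polyFun C (z + z⁻¹) := by
  rw [laurentFun_eq_map P hz, h]
  ext a b
  simp [dicksonSubst, polyFun, eval₂_aeval hz]

lemma exists_add_inv_eq (y : ℂ) : ∃ z : ℂ, z ≠ 0 ∧ z + z⁻¹ = y := by
  obtain ⟨s, hs⟩ := IsAlgClosed.exists_pow_nat_eq (y ^ 2 - 4) two_pos
  have hmul : (y + s) / 2 * ((y - s) / 2) = 1 := by linear_combination -hs / 4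
  refine ⟨(y + s) / 2, left_ne_zero_of_mul_eq_one hmul, ?_⟩
  rw [inv_eq_of_mul_eq_one_right hmul]
  ring

/-- Evaluation at `z` and at `z⁻¹` separates the two summands, and every complex number is of the
form `z + z⁻¹`. -/
lemma splitting_unique {b c b' c' : ℂ[X]} (h : ∀ z : ℂ, z ≠ 0 →
    b.eval (z + z⁻¹) + (z - z⁻¹) * c.eval (z + z⁻¹) =
      b'.eval (z + z⁻¹) + (z - z⁻¹) * c'.eval (z + z⁻¹)) : b = b' ∧ c = c' := by
  have h' : ∀ z : ℂ, z ≠ 0 → b.eval (z + z⁻¹) - (z - z⁻¹) * c.eval (z + z⁻¹) =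
      b'.eval (z + z⁻¹) - (z - z⁻¹) * c'.eval (z + z⁻¹) := fun z hz => by
    have := h z⁻¹ (inv_ne_zero hz)
    rw [inv_inv, add_comm z⁻¹ z] at this
    linear_combination this
  constructor
  · refine Polynomial.funext fun y => ?_
    obtain ⟨z, hz, rfl⟩ := exists_add_inv_eq y
    linear_combination (h z hz + h' z hz) / 2
  · -- the factor `w ^ 2 = y ^ 2 - 4` removes the points `y = ± 2`, at which `w = 0`
    have hX : (Polynomial.X ^ 2 - Polynomial.C 4 : ℂ[X]) ≠ 0 :=
      Polynomial.X_pow_sub_C_ne_zero two_pos _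
    refine mul_left_cancel₀ hX (Polynomial.funext fun y => ?_)
    obtain ⟨z, hz, rfl⟩ := exists_add_inv_eq y
    have hw : (z + z⁻¹) ^ 2 - 4 = (z - z⁻¹) ^ 2 := by field_simp; ring
    simp only [Polynomial.eval_mul, Polynomial.eval_sub, Polynomial.eval_pow, Polynomial.eval_X,
      Polynomial.eval_C, hw]
    linear_combination (z - z⁻¹) * (h z hz - h' z hz) / 2

lemma existsUnique_isSplitting {ι : Type*} (P : Matrix ι ι ℂ[T;T⁻¹]) :
    ∃! BC : Matrix ι ι ℂ[X] × Matrix ι ι ℂ[X], IsSplitting P BC.1 BC.2 := by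
  choose b c hbc using fun i j => exists_splitting (P i j)
  have hsplit : IsSplitting P (Matrix.of b) (Matrix.of c) := by
    ext1 i j
    simpa [dicksonSubst] using hbc i j
  refine ⟨(Matrix.of b, Matrix.of c), hsplit, ?_⟩
  rintro ⟨B, C⟩ h
  have key : ∀ i j, B i j = b i j ∧ C i j = c i j := fun i j => by
    refine splitting_unique fun z hz => ?_
    have := congrFun (congrFun ((h.laurentFun_eq hz).symm.trans (hsplit.laurentFun_eq hz)) i) j
    simpa [polyFun] using this
  exact Prod.ext (Matrix.ext fun i j => (key i j).1) (Matrix.ext fun i j => (key i j).2)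

end Splitting

/-! ### Diagonalization of the doubled matrix -/

section Doubled

variable {ι : Type*} [DecidableEq ι]

lemma sub_inv_ne_zero {z : ℂ} (h0 : z ≠ 0) (h1 : z ≠ 1) (h2 : z ≠ -1) : z - z⁻¹ ≠ 0 := by
  intro h
  have : (z - 1) * (z + 1) = 0 := by
    field_simp at h
    linear_combination h
  rcases mul_eq_zero.mp this with h | h
  · exact h1 (sub_eq_zero.mp h)
  · exact h2 (eq_neg_of_add_eq_zero_left h)

/-- The matrix `[[w, -w], [1, 1]]` with `w = z - z⁻¹`. It diagonalizes `[[0, w ^ 2], [1, 0]]`, and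
with it every block matrix `[[B, w ^ 2 C], [C, B]]`, into the blocks `B + w C` and `B - w C`. -/
noncomputable def eigenblock (ι : Type*) [DecidableEq ι] (z : ℂ) : Matrix (ι ⊕ ι) (ι ⊕ ι) ℂ :=
  Matrix.fromBlocks ((z - z⁻¹) • 1) (-(z - z⁻¹) • 1) 1 1

/-- The inverse of `eigenblock ι z`, for `z ≠ z⁻¹`. -/
noncomputable def eigenblockInv (ι : Type*) [DecidableEq ι] (z : ℂ) : Matrix (ι ⊕ ι) (ι ⊕ ι) ℂ :=
  (2 * (z - z⁻¹))⁻¹ • Matrix.fromBlocks 1 ((z - z⁻¹) • 1) (-1) ((z - z⁻¹) • 1)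

lemma isAnalyticAt_eigenblock {z₀ : ℂ} (hz : z₀ ≠ 0) : IsAnalyticAt (eigenblock ι) z₀ := by
  rintro (i | i) (j | j) <;> simp only [eigenblock, Matrix.fromBlocks_apply₁₁,
    Matrix.fromBlocks_apply₁₂, Matrix.fromBlocks_apply₂₁, Matrix.fromBlocks_apply₂₂,
    Matrix.smul_apply, smul_eq_mul] <;> fun_prop (disch := exact hz)

lemma isAnalyticAt_eigenblockInv {z₀ : ℂ} (hz : z₀ ≠ 0) (hw : z₀ - z₀⁻¹ ≠ 0) :
    IsAnalyticAt (eigenblockInv ι) z₀ := by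
  have hd : AnalyticAt ℂ (fun z : ℂ => (2 * (z - z⁻¹))⁻¹) z₀ :=
    AnalyticAt.inv (by fun_prop (disch := exact hz)) (mul_ne_zero two_ne_zero hw)
  rintro (i | i) (j | j) <;> simp only [eigenblockInv, Matrix.smul_apply,
    Matrix.fromBlocks_apply₁₁, Matrix.fromBlocks_apply₁₂, Matrix.fromBlocks_apply₂₁,
    Matrix.fromBlocks_apply₂₂, smul_eq_mul] <;>
    exact hd.mul (by fun_prop (disch := exact hz))

variable [Fintype ι]

lemma eigenblockInv_mul_eigenblock {z : ℂ} (hw : z - z⁻¹ ≠ 0) :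
    eigenblockInv ι z * eigenblock ι z = 1 := by
  unfold eigenblock eigenblockInv
  generalize z - z⁻¹ = w at hw ⊢
  rw [Matrix.smul_mul, Matrix.fromBlocks_multiply, ← Matrix.fromBlocks_one, Matrix.fromBlocks_smul]
  have h2 : (2 * w)⁻¹ * (w + w) = 1 := by rw [← two_mul, inv_mul_cancel₀ (by simpa using hw)]
  congr 1
  · rw [mul_one, one_mul, ← add_smul, smul_smul, h2, one_smul]
  · simp
  · simp
  · rw [mul_one, neg_smul, neg_mul_neg, one_mul, ← add_smul, smul_smul, h2, one_smul]

lemma polyFun_doubled_mul_eigenblock {P : Matrix ι ι ℂ[T;T⁻¹]} {B C : Matrix ι ι ℂ[X]}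
    (h : IsSplitting P B C) {z : ℂ} (hz : z ≠ 0) :
    polyFun (doubled B C) (z + z⁻¹) * eigenblock ι z = eigenblock ι z *
      Matrix.fromBlocks (laurentFun P z) 0 0 (laurentFun P z⁻¹) := by
  have hw : (z + z⁻¹) ^ 2 - 4 = (z - z⁻¹) * (z - z⁻¹) := by field_simp; ring
  have hM : polyFun (doubled B C) (z + z⁻¹) =
      Matrix.fromBlocks (polyFun B (z + z⁻¹))
        (((z - z⁻¹) * (z - z⁻¹)) • polyFun C (z + z⁻¹))
        (polyFun C (z + z⁻¹)) (polyFun B (z + z⁻¹)) := by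
    rw [← hw]
    ext (i | i) (j | j) <;> simp [polyFun, doubled]
  rw [hM, h.laurentFun_eq hz, h.laurentFun_eq (inv_ne_zero hz), inv_inv, add_comm z⁻¹ z, eigenblock,
    Matrix.fromBlocks_multiply, Matrix.fromBlocks_multiply]
  congr 1 <;> ext i j <;> simp <;> ring

/-- If `F E = E G` near `z₀` and `E z₀` has a left inverse, then `E z₀` embeds the leading vectors
of `G` into those of `F`. For invertible `E` this applies in both directions. -/
lemma finrank_leadSpace_le_of_mul_eq {κ : Type*} [Fintype κ] {F : ℂ → Matrix κ κ ℂ}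
    {G : ℂ → Matrix ι ι ℂ} {E : ℂ → Matrix κ ι ℂ} {E' : ℂ → Matrix ι κ ℂ} {z₀ : ℂ}
    (hE : IsAnalyticAt E z₀) (h : ∀ᶠ z in 𝓝 z₀, F z * E z = E z * G z)
    (hinv : E' z₀ * E z₀ = 1) (m : ℕ) :
    Module.finrank ℂ (leadSpace G z₀ m) ≤ Module.finrank ℂ (leadSpace F z₀ m) := by
  have hinj : Function.Injective (E z₀).mulVecLin := by
    refine Function.LeftInverse.injective (g := (E' z₀).mulVecLin) fun v => ?_
    simp [Matrix.mulVec_mulVec, hinv]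
  rw [((leadSpace G z₀ m).equivMapOfInjective _ hinj).finrank_eq]
  refine Submodule.finrank_mono ?_
  rintro _ ⟨v, hv, rfl⟩
  exact mulVec_mem_leadSpace hE hE h hv

lemma det_polyFun_doubled {P : Matrix ι ι ℂ[T;T⁻¹]} {B C : Matrix ι ι ℂ[X]}
    (h : IsSplitting P B C) {z : ℂ} (hz : z ≠ 0) (hw : z - z⁻¹ ≠ 0) :
    (polyFun (doubled B C) (z + z⁻¹)).det = (laurentFun P z).det * (laurentFun P z⁻¹).det := by
  have hE : (eigenblock ι z).det ≠ 0 := fun h0 => by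
    have := congrArg Matrix.det (eigenblockInv_mul_eigenblock (ι := ι) hw)
    rw [Matrix.det_mul, h0, mul_zero, Matrix.det_one] at this
    exact zero_ne_one this
  have := congrArg Matrix.det (polyFun_doubled_mul_eigenblock h hz)
  rw [Matrix.det_mul, Matrix.det_mul, Matrix.det_fromBlocks_zero₂₁, mul_comm] at this
  exact mul_left_cancel₀ hE this

/-- The spaces of leading vectors of the doubled matrix at `z₀ + z₀⁻¹`: passing to the local
parameter `z` and conjugating by `eigenblock ι z` turns the doubled matrix into
`diag (P z, P z⁻¹)`. -/
lemma finrank_leadSpace_doubled {P : Matrix ι ι ℂ[T;T⁻¹]} {B C : Matrix ι ι ℂ[X]}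
    (h : IsSplitting P B C) {z₀ : ℂ} (hz : z₀ ≠ 0) (hw : z₀ - z₀⁻¹ ≠ 0) (m : ℕ) :
    Module.finrank ℂ (leadSpace (polyFun (doubled B C)) (z₀ + z₀⁻¹) m) =
      Module.finrank ℂ (leadSpace (laurentFun P) z₀ m) +
        Module.finrank ℂ (leadSpace (laurentFun P) z₀⁻¹ m) := by
  have hinvd : HasDerivAt (fun z : ℂ => z⁻¹) (-(z₀ ^ 2)⁻¹) z₀ := hasDerivAt_inv hz
  have hinv : AnalyticAt ℂ (fun z : ℂ => z⁻¹) z₀ := analyticAt_id.inv hz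
  have hadd : deriv (fun z : ℂ => z + z⁻¹) z₀ ≠ 0 := by
    rw [((hasDerivAt_id' z₀).fun_add hinvd).deriv]
    intro h0
    refine hw ?_
    field_simp at h0 ⊢
    linear_combination h0
  rw [← leadSpace_comp (φ := fun z => z + z⁻¹) (analyticAt_id.add hinv) rfl hadd,
    ← leadSpace_comp (F := laurentFun P) hinv rfl (by rw [hinvd.deriv]; simpa using hz),
    ← finrank_leadSpace_fromBlocks]
  have hw' : ∀ᶠ z : ℂ in 𝓝 z₀, z ≠ 0 ∧ z - z⁻¹ ≠ 0 :=
    (eventually_ne_nhds hz).and ((analyticAt_id.sub hinv).continuousAt.eventually_ne hw)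
  have hinv' : ∀ {z : ℂ}, z - z⁻¹ ≠ 0 → eigenblock ι z * eigenblockInv ι z = 1 := fun hz =>
    mul_eq_one_comm.mp (eigenblockInv_mul_eigenblock hz)
  refine le_antisymm ?_ ?_
  · refine finrank_leadSpace_le_of_mul_eq (E' := eigenblock ι)
      (isAnalyticAt_eigenblockInv hz hw) ?_ (hinv' hw) m
    filter_upwards [hw'] with z hz'
    have := congrArg (fun A => eigenblockInv ι z * A * eigenblockInv ι z)
      (polyFun_doubled_mul_eigenblock h hz'.1)
    simp only [← mul_assoc, eigenblockInv_mul_eigenblock hz'.2, one_mul] at this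
    rw [← this, mul_assoc, hinv' hz'.2, mul_one]
  · refine finrank_leadSpace_le_of_mul_eq (E' := eigenblockInv ι)
      (isAnalyticAt_eigenblock hz) ?_ (eigenblockInv_mul_eigenblock hw) m
    filter_upwards [hw'] with z hz'
    exact polyFun_doubled_mul_eigenblock h hz'.1

end Doubled

end PalindromicPencil

open PalindromicPencil
theorem mainTheorem1 (n : ℕ) (P : Matrix (Fin n) (Fin n) ℂ[T;T⁻¹])
    (hpal : IsTPalindromic P) (hreg : P.det ≠ 0) :
    (∃! BC : Matrix (Fin n) (Fin n) ℂ[X] × Matrix (Fin n) (Fin n) ℂ[X],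
      IsSplitting P BC.1 BC.2) ∧
    ∀ B C : Matrix (Fin n) (Fin n) ℂ[X], IsSplitting P B C →
      ∀ z₀ : ℂ, z₀ ≠ 0 → z₀ ≠ 1 → z₀ ≠ -1 →
        ((polyFun (doubled B C) (z₀ + z₀⁻¹)).det = 0 ↔ (laurentFun P z₀).det = 0) ∧
        ((polyFun (doubled B C) (z₀ + z₀⁻¹)).det = 0 ↔ (laurentFun P z₀⁻¹).det = 0) ∧
        ∃ σ τ : Multiset ℕ,
          HasJordanStructure (laurentFun P) z₀ σ ∧
          HasJordanStructure (laurentFun P) z₀⁻¹ τ ∧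
          HasJordanStructure (polyFun (doubled B C)) (z₀ + z₀⁻¹) (σ + τ) := by
  refine ⟨existsUnique_isSplitting P, fun B C h z₀ hz h1 h2 => ?_⟩
  have hw := sub_inv_ne_zero hz h1 h2
  have hz' : z₀⁻¹ ≠ 0 := inv_ne_zero hz
  have hinv : (laurentFun P z₀⁻¹).det = (laurentFun P z₀).det := by
    rw [laurentFun_inv_of_isTPalindromic hpal hz, Matrix.det_transpose]
  refine ⟨?_, ?_, ?_⟩
  · rw [det_polyFun_doubled h hz hw, hinv, mul_self_eq_zero]
  · rw [det_polyFun_doubled h hz hw, hinv, mul_self_eq_zero]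
  have hfin := finrank_leadSpace_doubled h hz hw
  have hP := isAnalyticAt_laurentFun P hz
  have hP' := isAnalyticAt_laurentFun P hz'
  obtain ⟨N, hN⟩ := exists_leadSpace_eq_bot hP (analyticOrderAt_det_laurentFun_ne_top hreg hz)
  obtain ⟨N', hN'⟩ := exists_leadSpace_eq_bot hP' (analyticOrderAt_det_laurentFun_ne_top hreg hz')
  obtain ⟨σ, hσ, hσ0, hσc⟩ := exists_hasJordanStructure hP hN
  obtain ⟨τ, hτ, hτ0, hτc⟩ := exists_hasJordanStructure hP' hN'
  refine ⟨σ, τ, hσ, hτ, ?_⟩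
  have hM : leadSpace (polyFun (doubled B C)) (z₀ + z₀⁻¹) (max N N') = ⊥ := by
    have e1 := eq_bot_mono (leadSpace_anti _ _ (le_max_left N N')) hN
    have e2 := eq_bot_mono (leadSpace_anti _ _ (le_max_right N N')) hN'
    rw [← Submodule.finrank_eq_zero (R := ℂ), hfin, e1, e2, finrank_bot]
  refine hasJordanStructure_of_countP (isAnalyticAt_polyFun _ _) hM (by simp [hσ0, hτ0]) ?_
  intro m hm
  rw [Multiset.countP_add, hσc m hm, hτc m hm, hfin]
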